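/- Let $\beta$ be a Pisot number, that is, a real algebraic integer $\beta>1$ all of whose Galois conjugates other than $\beta$ have modulus less than $1$, and let $N(\beta)\in\mathbb{Z}$ be its norm for the extension $\mathbb{Q}(\beta)/\mathbb{Q}$. Put $T_\beta(x)=\beta x-\lfloor\beta x\rfloor$. The $\beta$-expansion of $x\in[0,1)$ is the sequence of digits $d_\beta(x)=(u_i)_{i\ge 1}$ with $u_i=\lfloor\beta\, T_\beta^{\,i-1}(x)\rfloor$. It is called finite if $u_i=0$ for all sufficiently large $i$, and purely periodic if there is $\ell\ge 1$ with $u_{i+\ell}=u_i$ for all $i\ge 1$. Assume that $\beta$ has the finiteness property (F): every $x\in\mathbb{Z}[1/\beta]\cap[0,1)$ has a finite $\beta$-expansion. Then there exist a real number $\varepsilon>0$ and an integer $D\ge 0$ such that for all integers $p,q$ with $q\ne 0$ and $x=p/q\in[0,1)$: if $x\le\varepsilon$, $\gcd(N(\beta),q)=1$ and $N(\beta)^D$ divides $p$, then the $\beta$-expansion of $x$ is purely periodic. -/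

import Mathlib

/-- The `β`-transformation `T_β : x ↦ βx mod 1`. -/
noncomputable def betaTransform (β x : ℝ) : ℝ := Int.fract (β * x)

/-- The sequence of digits of the greedy `β`-expansion `d_β(x)` of `x ∈ [0, 1)`, indexed from `0`:
the `i`-th term is `⌊β T_β^i(x)⌋`, the digit in front of `β^{-(i+1)}`. -/
noncomputable def betaExpansion (β x : ℝ) (i : ℕ) : ℤ := ⌊β * (betaTransform β)^[i] x⌋

/-- The `β`-expansion of `x` is finite: all but finitely many digits vanish. -/
def HasFiniteBetaExpansion (β x : ℝ) : Prop :=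
  ∃ n : ℕ, ∀ i : ℕ, n ≤ i → betaExpansion β x i = 0

/-- The `β`-expansion of `x` is purely periodic. -/
def HasPurelyPeriodicBetaExpansion (β x : ℝ) : Prop :=
  ∃ l : ℕ, 0 < l ∧ ∀ i : ℕ, betaExpansion β x (i + l) = betaExpansion β x i

/-- A Pisot number: a real algebraic integer `β > 1` all of whose other Galois conjugates
have modulus less than `1`. -/
structure IsPisotNumber (β : ℝ) : Prop where
  one_lt : 1 < β
  isIntegral : IsIntegral ℤ β
  norm_conj_lt_one : ∀ z : ℂ, Polynomial.aeval z (minpoly ℚ β) = 0 → z ≠ (β : ℂ) → ‖z‖ < 1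

/-- The finiteness property (F): every element of `ℤ[1/β] ∩ [0, 1)` has a finite
`β`-expansion. -/
def FinitenessProperty (β : ℝ) : Prop :=
  ∀ x : ℝ, x ∈ Algebra.adjoin ℤ {β⁻¹} → x ∈ Set.Ico (0 : ℝ) 1 → HasFiniteBetaExpansion β x

/-- The norm `N(β)` of `β` for the extension `ℚ(β)/ℚ`, as an integer. Taking the numerator loses
nothing when `β` is an algebraic integer, see `coe_betaNorm`. -/
noncomputable def betaNorm (β : ℝ) : ℤ :=
  (Algebra.norm ℚ (IntermediateField.AdjoinSimple.gen ℚ β)).num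

/-- For an algebraic integer `β`, the integer `betaNorm β` is the norm of `β`. -/
theorem coe_betaNorm {β : ℝ} (hβ : IsIntegral ℤ β) :
    (betaNorm β : ℚ) = Algebra.norm ℚ (IntermediateField.AdjoinSimple.gen ℚ β) := by
  have h1 : IsIntegral ℤ (IntermediateField.AdjoinSimple.gen ℚ β) := by
    refine (isIntegral_algHom_iff
      ((IntermediateField.val (IntermediateField.adjoin ℚ {β})).restrictScalars ℤ)
      Subtype.val_injective).1 ?_
    simpa using hβ
  obtain ⟨n, hn⟩ := IsIntegrallyClosed.isIntegral_iff.1 (Algebra.isIntegral_norm ℚ h1)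
  rw [betaNorm, ← hn]
  simp

/-! It suffices to find one point `v` whose orbit meets `x = p/q` at two different times. For every
large `n`, coprimality and divisibility give `u` with `q * u` integral and `z = β^n u - x/β^L` in
`ℤ[β]`; reducing modulo `ℤ[β]` puts `u` in a finite set independent of `n`. The other conjugates of
`z` are at most `1`, so by (F) `z/β^(n+s)` has at most `n+s+L` digits
(`FinitenessProperty.exists_iterate_eq_zero`). As `x ≤ ε`, adding `x/β^(n+s+L)` causes no carry
(`IsPisotNumber.eventually_add_div_pow_lt_one`), so the expansion of `u/β^s` is those digits
followed by the expansion of `x`. By pigeonhole some `u` serves two values of `n`. -/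

open Polynomial in
theorem IsIntegral.mem_adjoin_int_inv {β : ℝ} (h : IsIntegral ℤ β) (h0 : β ≠ 0) :
    β ∈ Algebra.adjoin ℤ {β⁻¹} := by
  obtain ⟨p, hp, hp0⟩ := h
  have hinv : β⁻¹ ∈ Algebra.adjoin ℤ {β⁻¹} := Algebra.self_mem_adjoin_singleton ℤ _
  rw [← aeval_def, aeval_eq_sum_range, Finset.sum_range_succ, hp.coeff_natDegree, one_smul] at hp0
  rcases Nat.eq_zero_or_pos p.natDegree with hd | hd
  · simp [hd] at hp0
  -- The monic equation divided by `β^(d-1)`. Hence `ℤ[β] ⊆ ℤ[1/β]`, and (F) applies to `ℤ[β]`.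
  have key : β = -∑ i ∈ Finset.range p.natDegree,
      p.coeff i • (β⁻¹) ^ (p.natDegree - 1 - i) := by
    have hne : β ^ (p.natDegree - 1) ≠ 0 := pow_ne_zero _ h0
    apply mul_left_cancel₀ hne
    have h1 : β ^ (p.natDegree - 1) * β = β ^ p.natDegree := by
      rw [← pow_succ, Nat.sub_add_cancel hd]
    rw [h1, eq_neg_of_add_eq_zero_right hp0, mul_neg, Finset.mul_sum]
    refine congrArg _ (Finset.sum_congr rfl fun i hi ↦ ?_)
    rw [Finset.mem_range] at hi
    rw [mul_smul_comm, inv_pow, ← div_eq_mul_inv, eq_comm]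
    congr 1
    rw [div_eq_iff (pow_ne_zero _ h0), ← pow_add]
    congr 1
    omega
  have := neg_mem (sum_mem fun i (_ : i ∈ Finset.range p.natDegree) ↦
    (Algebra.adjoin ℤ {β⁻¹}).smul_mem (pow_mem hinv (p.natDegree - 1 - i)) (p.coeff i))
  rwa [← key] at this

/-! ### Orbits of the `β`-transformation. -/

theorem betaTransform_mem_Ico (β x : ℝ) : betaTransform β x ∈ Set.Ico (0 : ℝ) 1 :=
  ⟨Int.fract_nonneg _, Int.fract_lt_one _⟩

theorem betaTransform_iterate_mem_Ico {β x : ℝ} (hx : x ∈ Set.Ico (0 : ℝ) 1) (n : ℕ) :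
    (betaTransform β)^[n] x ∈ Set.Ico (0 : ℝ) 1 := by
  cases n with
  | zero => exact hx
  | succ n => rw [Function.iterate_succ_apply']; exact betaTransform_mem_Ico _ _

theorem betaTransform_iterate_zero (β : ℝ) (n : ℕ) : (betaTransform β)^[n] 0 = 0 :=
  Function.iterate_fixed (by simp [betaTransform]) n

theorem HasFiniteBetaExpansion.exists_iterate_eq_zero {β x : ℝ} (hβ : 1 < β)
    (hx : x ∈ Set.Ico (0 : ℝ) 1) (h : HasFiniteBetaExpansion β x) :
    ∃ n, (betaTransform β)^[n] x = 0 := by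
  obtain ⟨n, hn⟩ := h
  refine ⟨n, ?_⟩
  by_contra hne
  have hpos : 0 < (betaTransform β)^[n] x :=
    lt_of_le_of_ne (betaTransform_iterate_mem_Ico hx n).1 (Ne.symm hne)
  -- Once the digits vanish, the map is multiplication by `β`, so a nonzero orbit would leave `[0,
  -- 1)`.
  have key : ∀ i, (betaTransform β)^[n + i] x = β ^ i * (betaTransform β)^[n] x := by
    intro i
    induction i with
    | zero => simp
    | succ i ih =>
      have hd := hn (n + i) (Nat.le_add_right _ _)
      rw [betaExpansion] at hd
      rw [← add_assoc, Function.iterate_succ_apply', betaTransform, Int.fract, hd, ih]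
      push_cast
      ring
  obtain ⟨i, hi⟩ := pow_unbounded_of_one_lt ((betaTransform β)^[n] x)⁻¹ hβ
  have h1 := (betaTransform_iterate_mem_Ico (β := β) hx (n + i)).2
  rw [key] at h1
  rw [inv_lt_iff_one_lt_mul₀ hpos] at hi
  linarith

theorem hasPurelyPeriodicBetaExpansion_of_iterate_eq {β x v : ℝ} {m n : ℕ} (hmn : m < n)
    (hm : (betaTransform β)^[m] v = x) (hn : (betaTransform β)^[n] v = x) :
    HasPurelyPeriodicBetaExpansion β x := by
  obtain ⟨l, rfl⟩ := Nat.exists_eq_add_of_lt hmn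
  refine ⟨l + 1, Nat.succ_pos _, fun i ↦ ?_⟩
  have h : (betaTransform β)^[l + 1] x = x := by
    conv_lhs => rw [← hm]
    rw [← Function.iterate_add_apply, ← hn]
    congr 1
    omega
  rw [betaExpansion, betaExpansion, Function.iterate_add_apply, h]

/-- Addition without carry: while the sums stay below `1`, the perturbation changes no digit and is
only scaled by `β`. -/
theorem betaTransform_iterate_add {β y h : ℝ} (hβ : 0 ≤ β) (hh : 0 ≤ h) {m : ℕ}
    (hlt : ∀ i ≤ m, (betaTransform β)^[i] y + β ^ i * h < 1) :
    (betaTransform β)^[m] (y + h) = (betaTransform β)^[m] y + β ^ m * h := by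
  induction m with
  | zero => simp
  | succ m ih =>
    have h1 := hlt (m + 1) le_rfl
    rw [Function.iterate_succ_apply', ih fun i hi ↦ hlt i (by omega)]
    rw [Function.iterate_succ_apply'] at h1 ⊢
    generalize (betaTransform β)^[m] y = a at h1 ⊢
    have h2 : 0 ≤ betaTransform β a + β ^ (m + 1) * h :=
      add_nonneg (Int.fract_nonneg _) (by positivity)
    refine Int.fract_eq_iff.2 ⟨h2, h1, ⌊β * a⌋, ?_⟩
    rw [betaTransform, Int.fract]
    ring

/-! ### The field `ℚ(β)`, its embeddings and the norm of `β`. -/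

/-- The field `ℚ(β)`. -/
noncomputable abbrev BetaField (β : ℝ) := IntermediateField.adjoin ℚ {β}

/-- The generator `β` of `ℚ(β)`. -/
noncomputable abbrev betaGen (β : ℝ) : BetaField β := IntermediateField.AdjoinSimple.gen ℚ β

/-- The ring `ℤ[β]` inside `ℚ(β)`. -/
noncomputable abbrev BetaRing (β : ℝ) : Subalgebra ℤ (BetaField β) := Algebra.adjoin ℤ {betaGen β}

/-- The inclusion `ℚ(β) → ℂ`. -/
noncomputable def betaEmbedding (β : ℝ) : BetaField β →+* ℂ :=
  (algebraMap ℝ ℂ).comp (algebraMap (BetaField β) ℝ)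

theorem betaEmbedding_apply (β : ℝ) (a : BetaField β) : betaEmbedding β a = ((a : ℝ) : ℂ) := rfl

theorem norm_betaEmbedding (β : ℝ) (a : BetaField β) : ‖betaEmbedding β a‖ = |(a : ℝ)| := by
  rw [betaEmbedding_apply, Complex.norm_real, Real.norm_eq_abs]

theorem coe_betaGen (β : ℝ) : (betaGen β : ℝ) = β := IntermediateField.AdjoinSimple.coe_gen ℚ β

theorem betaGen_mem (β : ℝ) : betaGen β ∈ BetaRing β := Algebra.self_mem_adjoin_singleton ℤ _

theorem isIntegral_betaGen {β : ℝ} (hβ : IsIntegral ℤ β) : IsIntegral ℤ (betaGen β) :=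
  (isIntegral_algHom_iff ((IntermediateField.val (BetaField β)).restrictScalars ℤ)
    Subtype.val_injective).1 (by simpa using hβ)

theorem isIntegral_of_mem_betaRing {β : ℝ} (hβ : IsIntegral ℤ β) {a : BetaField β}
    (ha : a ∈ BetaRing β) : IsIntegral ℤ a := by
  have : BetaRing β ≤ integralClosure ℤ (BetaField β) :=
    Algebra.adjoin_le (Set.singleton_subset_iff.2 (isIntegral_betaGen hβ))
  exact this ha

theorem coe_mem_adjoin_inv {β : ℝ} (hβ : IsIntegral ℤ β) (h0 : β ≠ 0) {a : BetaField β}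
    (ha : a ∈ BetaRing β) : (a : ℝ) ∈ Algebra.adjoin ℤ {β⁻¹} := by
  have : BetaRing β ≤ (Algebra.adjoin ℤ {β⁻¹}).comap
      ((IntermediateField.val (BetaField β)).restrictScalars ℤ) :=
    Algebra.adjoin_le (by simpa using hβ.mem_adjoin_int_inv h0)
  exact this ha

theorem numberField_betaField {β : ℝ} (hβ : IsIntegral ℤ β) : NumberField (BetaField β) where
  to_finiteDimensional := IntermediateField.adjoin.finiteDimensional (hβ.tower_top)

theorem IsPisotNumber.norm_map_gen_lt_one {β : ℝ} (hβ : IsPisotNumber β)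
    {φ : BetaField β →+* ℂ} (hφ : φ ≠ betaEmbedding β) : ‖φ (betaGen β)‖ < 1 := by
  refine hβ.norm_conj_lt_one _ ?_ fun h ↦ hφ ?_
  · rw [← IntermediateField.minpoly_gen ℚ β]
    have := minpoly.aeval ℚ (betaGen β)
    apply_fun φ.toRatAlgHom at this
    rwa [← Polynomial.aeval_algHom_apply, map_zero] at this
  · have : φ.toRatAlgHom = (betaEmbedding β).toRatAlgHom := by
      refine IntermediateField.algHom_ext_of_eq_adjoin ℚ rfl ?_
      intro x hx
      obtain rfl : x = β := hx
      exact h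
    exact congrArg (fun f : BetaField β →ₐ[ℚ] ℂ ↦ (f : BetaField β →+* ℂ)) this

/-- In `ℤ[β]`, the generator divides the norm. -/
theorem exists_mul_betaGen_eq_betaNorm {β : ℝ} (hβ : IsIntegral ℤ β) :
    ∃ η ∈ BetaRing β, betaGen β * η = (betaNorm β : BetaField β) := by
  have hQ : IsIntegral ℚ β := hβ.tower_top
  have hg := isIntegral_betaGen hβ
  set p := minpoly ℤ (betaGen β) with hp
  have hmap : minpoly ℚ (IntermediateField.AdjoinSimple.gen ℚ β) = p.map (algebraMap ℤ ℚ) :=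
    minpoly.isIntegrallyClosed_eq_field_fractions' ℚ hg
  have hnorm := Algebra.PowerBasis.norm_gen_eq_coeff_zero_minpoly
    (IntermediateField.adjoin.powerBasis hQ)
  rw [IntermediateField.adjoin.powerBasis_gen] at hnorm
  replace hnorm := (coe_betaNorm hβ).trans <|
    hnorm.trans (congrArg (fun f : Polynomial ℚ ↦ _ * f.coeff 0) hmap)
  rw [Polynomial.coeff_map] at hnorm
  set d := (IntermediateField.adjoin.powerBasis hQ).dim
  have hN : betaNorm β = (-1) ^ d * p.coeff 0 := by
    have : (betaNorm β : ℚ) = (((-1) ^ d * p.coeff 0 : ℤ) : ℚ) := by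
      rw [hnorm]; push_cast; simp
    exact_mod_cast this
  have h0 : Polynomial.aeval (betaGen β) p = 0 := minpoly.aeval ℤ _
  -- The constant coefficient of `p` is the norm up to sign, and the rest of `p` is a multiple of
  -- `X`.
  rw [← Polynomial.divX_mul_X_add p, map_add, map_mul, Polynomial.aeval_X,
    Polynomial.aeval_C] at h0
  refine ⟨-(-1) ^ d * Polynomial.aeval (betaGen β) p.divX, ?_, ?_⟩
  · refine mul_mem (neg_mem (pow_mem (neg_mem (one_mem _)) _)) ?_
    exact Polynomial.aeval_mem_adjoin_singleton ℤ _
  · have h1 : Polynomial.aeval (betaGen β) p.divX * betaGen β = -(p.coeff 0 : BetaField β) := by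
      simpa using eq_neg_of_add_eq_zero_left h0
    rw [hN]
    push_cast
    linear_combination (-(-1) ^ d) * h1

/-! ### Conjugate bounds and finiteness. -/

/-- The iterates of the `β`-transformation are `β ^ n * y - w` with `w ∈ ℤ[β]` whose contracting
conjugates are bounded independently of `n`. -/
theorem exists_betaTransform_iterate_eq_sub {β y : ℝ} (hβ : 1 < β) (hy : y ∈ Set.Ico (0 : ℝ) 1)
    (n : ℕ) : ∃ w ∈ BetaRing β, (betaTransform β)^[n] y = β ^ n * y - (w : ℝ) ∧
      ∀ φ : BetaField β →+* ℂ, ‖φ (betaGen β)‖ < 1 → ‖φ w‖ ≤ β / (1 - ‖φ (betaGen β)‖) := by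
  induction n with
  | zero =>
    refine ⟨0, zero_mem _, by simp, fun φ hφ ↦ ?_⟩
    rw [map_zero, norm_zero]
    exact div_nonneg (by linarith) (by linarith)
  | succ n ih =>
    obtain ⟨w, hw, hwn, hwφ⟩ := ih
    have hT := betaTransform_iterate_mem_Ico (β := β) hy n
    set a := (betaTransform β)^[n] y with ha
    have hd0 : 0 ≤ ⌊β * a⌋ := Int.floor_nonneg.2 (mul_nonneg (by linarith) hT.1)
    have hdβ : (⌊β * a⌋ : ℝ) ≤ β := by nlinarith [Int.floor_le (β * a), hT.2]
    refine ⟨betaGen β * w + (⌊β * a⌋ : ℤ),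
      add_mem (mul_mem (betaGen_mem β) hw) (intCast_mem _ _), ?_, fun φ hφ ↦ ?_⟩
    · rw [Function.iterate_succ_apply', ← ha, betaTransform, Int.fract]
      push_cast
      rw [coe_betaGen]
      nth_rw 1 [hwn]
      ring
    · rw [map_add, map_mul, map_intCast]
      have h1 : 0 < 1 - ‖φ (betaGen β)‖ := by linarith
      have h2 := hwφ φ hφ
      have h3 : ‖((⌊β * a⌋ : ℤ) : ℂ)‖ ≤ β := by
        rw [Complex.norm_intCast, abs_of_nonneg (by exact_mod_cast hd0)]
        exact hdβ
      calc _ ≤ ‖φ (betaGen β)‖ * ‖φ w‖ + ‖((⌊β * a⌋ : ℤ) : ℂ)‖ :=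
            (norm_add_le _ _).trans_eq (by rw [norm_mul])
        -- The bound is the fixed point of `t ↦ ‖φ (betaGen β)‖ * t + β`.
        _ ≤ ‖φ (betaGen β)‖ * (β / (1 - ‖φ (betaGen β)‖)) + β := by gcongr
        _ = β / (1 - ‖φ (betaGen β)‖) := by field_simp; ring

theorem NumberField.finite_setOf_isIntegral_norm_le {K : Type*} [Field K] [NumberField K]
    (B : (K →+* ℂ) → ℝ) : {x : K | IsIntegral ℤ x ∧ ∀ φ : K →+* ℂ, ‖φ x‖ ≤ B φ}.Finite := by
  obtain ⟨M, hM⟩ := (Set.finite_range B).bddAbove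
  exact (NumberField.Embeddings.finite_of_norm_le K ℂ M).subset fun x hx ↦
    ⟨hx.1, fun φ ↦ (hx.2 φ).trans (hM ⟨φ, rfl⟩)⟩

/-- Every class of `ℚ(β)` modulo `ℤ[β]` has a representative in `[1, 2)` with bounded
conjugates. -/
theorem exists_sub_mem_Ico_norm_le {β : ℝ} (hβ : IsIntegral ℤ β) :
    ∃ C : ℝ, ∀ a : BetaField β, ∃ g ∈ BetaRing β, ((a - g : BetaField β) : ℝ) ∈ Set.Ico (1 : ℝ) 2 ∧
      ∀ φ : BetaField β →+* ℂ, ‖φ (a - g)‖ ≤ C := by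
  have := numberField_betaField hβ
  let pb := IntermediateField.adjoin.powerBasis (K := ℚ) (x := β) hβ.tower_top
  have hgen : pb.gen = betaGen β := IntermediateField.adjoin.powerBasis_gen _
  obtain ⟨C, hC⟩ := (Set.finite_range fun φ : BetaField β →+* ℂ ↦
    ∑ i : Fin pb.dim, ‖φ (betaGen β)‖ ^ (i : ℕ)).bddAbove
  replace hC : ∀ φ : BetaField β →+* ℂ, ∑ i : Fin pb.dim, ‖φ (betaGen β)‖ ^ (i : ℕ) ≤ C :=
    fun φ ↦ hC ⟨φ, rfl⟩
  refine ⟨2 * C + 2, fun a ↦ ?_⟩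
  -- Rounding down the coordinates in the power basis leaves coordinates in `[0, 1)`; an integer
  -- shift then reaches `[1, 2)`.
  set g := ∑ i, (⌊pb.basis.repr a i⌋ : BetaField β) * betaGen β ^ (i : ℕ) with hg
  have hgm : g ∈ BetaRing β :=
    sum_mem fun i _ ↦ mul_mem (intCast_mem _ _) (pow_mem (betaGen_mem β) _)
  have hag : a - g = ∑ i, ((Int.fract (pb.basis.repr a i) : ℚ) : BetaField β) *
      betaGen β ^ (i : ℕ) := by
    conv_lhs => rw [← pb.basis.sum_repr a]
    rw [hg, ← Finset.sum_sub_distrib]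
    refine Finset.sum_congr rfl fun i _ ↦ ?_
    rw [pb.basis_eq_pow, hgen, Int.fract, Algebra.smul_def, eq_ratCast]
    push_cast
    ring
  have hr : ∀ φ : BetaField β →+* ℂ, ‖φ (a - g)‖ ≤ C := by
    refine fun φ ↦ le_trans ?_ (hC φ)
    rw [hag, map_sum]
    refine norm_sum_le_of_le _ fun i _ ↦ ?_
    rw [map_mul, map_pow, norm_mul, norm_pow, map_ratCast]
    refine mul_le_of_le_one_left (by positivity) ?_
    rw [Complex.norm_ratCast, abs_of_nonneg (by exact_mod_cast Int.fract_nonneg _)]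
    exact_mod_cast (Int.fract_lt_one _).le
  set r := a - g with hr_def
  have h1 : a - (g + ((⌊(r : ℝ)⌋ - 1 : ℤ) : BetaField β)) =
      r - ((⌊(r : ℝ)⌋ - 1 : ℤ) : BetaField β) := by rw [hr_def]; ring
  refine ⟨g + ((⌊(r : ℝ)⌋ - 1 : ℤ) : BetaField β), add_mem hgm (intCast_mem _ _), ?_,
    fun φ ↦ ?_⟩
  · rw [h1]
    push_cast
    have h2 := Int.floor_le (r : ℝ)
    have h3 := Int.lt_floor_add_one (r : ℝ)
    constructor <;> linarith
  · rw [h1, map_sub, map_intCast]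
    have h2 := Int.floor_le (r : ℝ)
    have h3 := Int.lt_floor_add_one (r : ℝ)
    have h4 := hr (betaEmbedding β)
    rw [norm_betaEmbedding, abs_le] at h4
    have h5 : ‖((⌊(r : ℝ)⌋ - 1 : ℤ) : ℂ)‖ ≤ C + 2 := by
      rw [Complex.norm_intCast, abs_le]
      push_cast
      constructor <;> linarith
    have := norm_sub_le (φ r) ((⌊(r : ℝ)⌋ - 1 : ℤ) : ℂ)
    linarith [hr φ]

open Filter Topology in
/-- A number whose `β`-expansion stops after `k` digits stays away from `1` by a distance
comparable to `β ^ (-k)`. -/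
theorem IsPisotNumber.eventually_add_div_pow_lt_one {β : ℝ} (hβ : IsPisotNumber β) :
    ∀ᶠ ε : ℝ in 𝓝[>] 0, ∀ y ∈ Set.Ico (0 : ℝ) 1, ∀ k : ℕ, (betaTransform β)^[k] y = 0 →
      y + ε / β ^ k < 1 := by
  have := numberField_betaField hβ.isIntegral
  -- If `β^k (1 - y) = β^k - w` is below `1`, it lies in this finite set, whose positive elements
  -- are bounded below. The absolute value is for the identity embedding, where the quotient is
  -- negative.
  have hfin := NumberField.finite_setOf_isIntegral_norm_le (K := BetaField β)
    fun φ ↦ 1 + |β / (1 - ‖φ (betaGen β)‖)|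
  have h1 : ∀ᶠ ε : ℝ in 𝓝[>] 0, ε < 1 := eventually_nhdsWithin_of_eventually_nhds
    (eventually_lt_nhds one_pos)
  have h2 := (hfin.eventually_all (l := 𝓝[>] (0 : ℝ))
    (p := fun a ε ↦ 0 < (a : ℝ) → ε < (a : ℝ))).2 fun a _ ↦ by
      by_cases ha : 0 < (a : ℝ)
      · filter_upwards [eventually_nhdsWithin_of_eventually_nhds (eventually_lt_nhds ha)]
          with ε hε _ using hε
      · simp [ha]
  filter_upwards [h1, h2] with ε hε1 hε2 y hy k hk
  obtain ⟨w, hw, hwk, hwφ⟩ := exists_betaTransform_iterate_eq_sub hβ.one_lt hy k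
  have hpos : 0 < β ^ k := pow_pos (by linarith [hβ.one_lt]) k
  have hw' : (w : ℝ) = β ^ k * y := by linarith
  have hcoe : ((betaGen β ^ k - w : BetaField β) : ℝ) = β ^ k * (1 - y) := by
    push_cast
    rw [coe_betaGen, hw']
    ring
  have hlt : ε < β ^ k * (1 - y) := by
    rcases le_or_gt 1 (β ^ k * (1 - y)) with h | h
    · linarith
    rw [← hcoe] at h ⊢
    have h0 : 0 < ((betaGen β ^ k - w : BetaField β) : ℝ) := by
      rw [hcoe]
      exact mul_pos hpos (by linarith [hy.2])
    refine hε2 _ ⟨isIntegral_of_mem_betaRing hβ.isIntegral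
      (sub_mem (pow_mem (betaGen_mem β) _) hw), fun φ ↦ ?_⟩ h0
    by_cases hφ : φ = betaEmbedding β
    · rw [hφ, norm_betaEmbedding, abs_of_pos h0]
      exact h.le.trans (by linarith [abs_nonneg (β / (1 - ‖betaEmbedding β (betaGen β)‖))])
    · have hlt1 := hβ.norm_map_gen_lt_one hφ
      rw [map_sub, map_pow]
      refine (norm_sub_le _ _).trans (add_le_add ?_ ((hwφ φ hlt1).trans (le_abs_self _)))
      rw [norm_pow]
      exact pow_le_one₀ (norm_nonneg _) hlt1.le
  have : ε / β ^ k < 1 - y := by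
    rw [div_lt_iff₀ hpos]
    linarith
  linarith

/-- Under (F), the elements of `ℤ[β]` whose other conjugates lie in the unit disc have at most a
bounded number of fractional digits. -/
theorem FinitenessProperty.exists_iterate_eq_zero {β : ℝ} (hF : FinitenessProperty β)
    (hβ : IsPisotNumber β) :
    ∃ L : ℕ, ∀ z ∈ BetaRing β, (∀ φ : BetaField β →+* ℂ, φ ≠ betaEmbedding β → ‖φ z‖ ≤ 1) →
      ∀ k : ℕ, (z : ℝ) / β ^ k ∈ Set.Ico (0 : ℝ) 1 →
        (betaTransform β)^[k + L] ((z : ℝ) / β ^ k) = 0 := by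
  have := numberField_betaField hβ.isIntegral
  have hβ0 : 0 < β := by linarith [hβ.one_lt]
  have hfin := NumberField.finite_setOf_isIntegral_norm_le (K := BetaField β)
    fun φ ↦ 1 + |β / (1 - ‖φ (betaGen β)‖)|
  -- After `k` steps the orbit of `z/β^k` is at `z - w`, in a finite set, so one `L` suits all.
  have h1 := (hfin.eventually_all (l := Filter.atTop) (p := fun a L ↦ a ∈ BetaRing β →
    (a : ℝ) ∈ Set.Ico (0 : ℝ) 1 → (betaTransform β)^[L] (a : ℝ) = 0)).2 fun a _ ↦ by
      by_cases ha : a ∈ BetaRing β ∧ (a : ℝ) ∈ Set.Ico (0 : ℝ) 1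
      · obtain ⟨n, hn⟩ := (hF a (coe_mem_adjoin_inv hβ.isIntegral hβ0.ne' ha.1)
          ha.2).exists_iterate_eq_zero hβ.one_lt ha.2
        filter_upwards [Filter.eventually_ge_atTop n] with L hL _ _
        obtain ⟨j, rfl⟩ := Nat.exists_eq_add_of_le' hL
        rw [Function.iterate_add_apply, hn, betaTransform_iterate_zero]
      · exact Filter.Eventually.of_forall fun L h h' ↦ absurd ⟨h, h'⟩ ha
  obtain ⟨L, hL⟩ := h1.exists
  refine ⟨L, fun z hz hzφ k hzk ↦ ?_⟩
  obtain ⟨w, hw, hwk, hwφ⟩ := exists_betaTransform_iterate_eq_sub hβ.one_lt hzk k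
  have hT := betaTransform_iterate_mem_Ico (β := β) hzk k
  have hcoe : (betaTransform β)^[k] ((z : ℝ) / β ^ k) = ((z - w : BetaField β) : ℝ) := by
    rw [hwk, mul_div_cancel₀ _ (pow_pos hβ0 k).ne']
    push_cast
    rfl
  rw [add_comm, Function.iterate_add_apply, hcoe]
  rw [hcoe] at hT
  refine hL _ ⟨isIntegral_of_mem_betaRing hβ.isIntegral (sub_mem hz hw), fun φ ↦ ?_⟩
    (sub_mem hz hw) hT
  by_cases hφ : φ = betaEmbedding β
  · rw [hφ, norm_betaEmbedding, abs_of_nonneg hT.1]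
    linarith [hT.2, abs_nonneg (β / (1 - ‖betaEmbedding β (betaGen β)‖))]
  · rw [map_sub]
    exact (norm_sub_le _ _).trans (add_le_add (hzφ φ hφ)
      ((hwφ φ (hβ.norm_map_gen_lt_one hφ)).trans (le_abs_self _)))

/-! ### Arithmetic of `p/q` and the conclusion. -/

/-- Divisibility of `p` by a power of the norm, together with coprimality of the norm and `q`,
allows to write `p / q` modulo `ℤ[β]` with a numerator divisible by any power of `β`. -/
theorem exists_betaGen_pow_mul_sub_mem {β : ℝ} (hβ : IsIntegral ℤ β) (h0 : β ≠ 0)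
    {p q : ℤ} (hq : q ≠ 0)
    (hgcd : Int.gcd (betaNorm β) q = 1) {L : ℕ} (hdvd : betaNorm β ^ L ∣ p) (k : ℕ) :
    ∃ a : BetaField β, q * a ∈ BetaRing β ∧
      betaGen β ^ k * a - (p / q : BetaField β) / betaGen β ^ L ∈ BetaRing β := by
  obtain ⟨η, hη, hηN⟩ := exists_mul_betaGen_eq_betaNorm hβ
  obtain ⟨p₀, rfl⟩ := hdvd
  have hqK : (q : BetaField β) ≠ 0 := by exact_mod_cast hq
  have hg : betaGen β ≠ 0 := fun h ↦ h0 (by rw [← coe_betaGen β, h]; rfl)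
  have hcop : IsCoprime (betaNorm β) q := Int.isCoprime_iff_gcd_eq_one.2 hgcd
  have hcop' : IsCoprime ((⟨betaGen β, betaGen_mem β⟩ : BetaRing β) ^ k) (q : BetaRing β) := by
    have h1 : IsCoprime ((betaNorm β : ℤ) : BetaRing β) (q : BetaRing β) :=
      hcop.map (Int.castRingHom (BetaRing β))
    have h2 : ((betaNorm β : ℤ) : BetaRing β) = ⟨betaGen β, betaGen_mem β⟩ * ⟨η, hη⟩ :=
      Subtype.ext (by simpa using hηN.symm)
    rw [h2] at h1
    exact h1.of_mul_left_left.pow_left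
  obtain ⟨⟨s, hs⟩, ⟨r, hr⟩, hsr⟩ := hcop'
  replace hsr : s * betaGen β ^ k + r * q = 1 := by
    simpa using congrArg (fun a : BetaRing β ↦ (a : BetaField β)) hsr
  have hpη : (η ^ L * p₀ : BetaField β) ∈ BetaRing β := mul_mem (pow_mem hη _) (intCast_mem _ _)
  -- Since `N = β η`, the target `(p/q)/β^L` is `η^L p₀/q`, and `s` inverts `β^k` modulo `q`.
  refine ⟨s * (η ^ L * p₀) / q, ?_, ?_⟩
  · rw [mul_div_cancel₀ _ hqK]
    exact mul_mem hs hpη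
  · have h1 : betaGen β ^ k * (s * (η ^ L * p₀) / q) -
        (((betaNorm β ^ L * p₀ : ℤ) : BetaField β) / q) / betaGen β ^ L =
        -(r * (η ^ L * p₀)) := by
      push_cast
      rw [← hηN, mul_pow]
      field_simp
      linear_combination (η ^ L * p₀) * hsr
    rw [h1]
    exact neg_mem (mul_mem hr hpη)

theorem IsPisotNumber.exists_pow_mul_norm_le {β : ℝ} (hβ : IsPisotNumber β) (C : ℝ) :
    ∃ k₀ : ℕ, ∀ k ≥ k₀, ∀ φ : BetaField β →+* ℂ, φ ≠ betaEmbedding β →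
      ‖φ (betaGen β)‖ ^ k * C ≤ 1 / 2 := by
  have := numberField_betaField hβ.isIntegral
  refine Filter.eventually_atTop.1 (Filter.eventually_all.2 fun φ ↦ ?_)
  by_cases hφ : φ = betaEmbedding β
  · simp [hφ]
  · have := (tendsto_pow_atTop_nhds_zero_of_lt_one (norm_nonneg _)
      (hβ.norm_map_gen_lt_one hφ)).mul_const C
    rw [zero_mul] at this
    filter_upwards [this.eventually_le_const (by norm_num : (0 : ℝ) < 1 / 2)] with k hk _ using hk

open Filter Topology in
theorem mainTheorem1 (β : ℝ) (hβ : IsPisotNumber β) (hF : FinitenessProperty β) :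
    ∃ ε : ℝ, 0 < ε ∧ ∃ D : ℕ, ∀ p q : ℤ, q ≠ 0 →
      (p : ℝ) / (q : ℝ) ∈ Set.Ico (0 : ℝ) 1 →
      (p : ℝ) / (q : ℝ) ≤ ε →
      Int.gcd (betaNorm β) q = 1 →
      betaNorm β ^ D ∣ p →
      HasPurelyPeriodicBetaExpansion β ((p : ℝ) / (q : ℝ)) := by
  have := numberField_betaField hβ.isIntegral
  have hβ0 : 0 < β := by linarith [hβ.one_lt]
  have hg : betaGen β ≠ 0 := fun h ↦ hβ0.ne' (by rw [← coe_betaGen β, h]; rfl)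
  obtain ⟨L, hL⟩ := hF.exists_iterate_eq_zero hβ
  obtain ⟨C, hC⟩ := exists_sub_mem_Ico_norm_le hβ.isIntegral
  obtain ⟨k₀, hk₀⟩ := hβ.exists_pow_mul_norm_le C
  -- As `u < 2`, this gives `u/β^s < 1`; the lower bound `1 ≤ u` will give `0 ≤ z`.
  obtain ⟨s, hs⟩ := pow_unbounded_of_one_lt 2 hβ.one_lt
  -- Makes all conjugates of `x/β^L` at most `1/2`; the other half is left for `β^n u`.
  have hε2 : ∀ᶠ ε : ℝ in 𝓝[>] 0, ∀ φ : BetaField β →+* ℂ, ε ≤ ‖φ (betaGen β)‖ ^ L / 2 :=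
    eventually_all.2 fun φ ↦ eventually_nhdsWithin_of_eventually_nhds <| eventually_le_nhds <|
      half_pos <| pow_pos (norm_pos_iff.2 ((map_ne_zero φ).2 hg)) L
  obtain ⟨ε, ⟨hgap, hεφ⟩, hε⟩ :=
    ((hβ.eventually_add_div_pow_lt_one.and hε2).and self_mem_nhdsWithin).exists
  refine ⟨ε, hε, L, fun p q hq hx hxε hgcd hdvd ↦ ?_⟩
  set x : ℝ := (p : ℝ) / q with hx_def
  set S : Set (BetaField β) := {u | IsIntegral ℤ (q * u) ∧ ∀ φ : BetaField β →+* ℂ, ‖φ u‖ ≤ C}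
    with hS
  have hqK : (q : BetaField β) ≠ 0 := by exact_mod_cast hq
  have hSfin : S.Finite := by
    refine ((NumberField.finite_setOf_isIntegral_norm_le (K := BetaField β)
      fun _ ↦ |(q : ℝ)| * C).preimage (mul_right_injective₀ hqK).injOn).subset fun u hu ↦ ?_
    refine ⟨hu.1, fun φ ↦ ?_⟩
    rw [map_mul, map_intCast, norm_mul, Complex.norm_intCast]
    exact mul_le_mul_of_nonneg_left (hu.2 φ) (abs_nonneg _)
  have key : ∀ k : ℕ, ∃ u ∈ S, (betaTransform β)^[k₀ + k + s + L] ((u : ℝ) / β ^ s) = x := by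
    intro k
    obtain ⟨a, ha, hak⟩ :=
      exists_betaGen_pow_mul_sub_mem hβ.isIntegral hβ0.ne' hq hgcd hdvd (k₀ + k)
    obtain ⟨g, hgm, hag, hagφ⟩ := hC a
    have hkk := hk₀ (k₀ + k) (Nat.le_add_right _ _)
    generalize k₀ + k = n at hak hkk ⊢
    have hu : IsIntegral ℤ (q * (a - g)) := by
      rw [mul_sub]
      exact isIntegral_of_mem_betaRing hβ.isIntegral
        (sub_mem ha (mul_mem (intCast_mem _ _) hgm))
    have hz : betaGen β ^ n * (a - g) - (p / q : BetaField β) / betaGen β ^ L ∈ BetaRing β := by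
      rw [mul_sub, sub_right_comm]
      exact sub_mem hak (mul_mem (pow_mem (betaGen_mem β) _) hgm)
    refine ⟨a - g, ⟨hu, hagφ⟩, ?_⟩
    generalize a - g = u at hag hagφ hz
    set z := betaGen β ^ n * u - (p / q : BetaField β) / betaGen β ^ L with hz_def
    have hzx : (z : ℝ) = β ^ n * u - x / β ^ L := by
      rw [hz_def]
      push_cast
      rw [coe_betaGen]
    have hzφ : ∀ φ : BetaField β →+* ℂ, φ ≠ betaEmbedding β → ‖φ z‖ ≤ 1 := by
      intro φ hφ
      have h0 : 0 < ‖φ (betaGen β)‖ ^ L := pow_pos (norm_pos_iff.2 ((map_ne_zero φ).2 hg)) L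
      have h1 : ‖φ ((p / q : BetaField β) / betaGen β ^ L)‖ ≤ 1 / 2 := by
        rw [map_div₀, map_div₀, map_intCast, map_intCast, map_pow, norm_div, norm_div, norm_pow,
          Complex.norm_intCast, Complex.norm_intCast, ← abs_div, ← hx_def, abs_of_nonneg hx.1,
          div_le_iff₀ h0]
        linarith [hεφ φ]
      have h2 : ‖φ (betaGen β ^ n * u)‖ ≤ 1 / 2 := by
        rw [map_mul, map_pow, norm_mul, norm_pow]
        exact (mul_le_mul_of_nonneg_left (hagφ φ) (by positivity)).trans (hkk φ hφ)
      rw [hz_def, map_sub]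
      linarith [norm_sub_le (φ (betaGen β ^ n * u)) (φ ((p / q : BetaField β) / betaGen β ^ L))]
    have hzu : (z : ℝ) / β ^ (n + s) + x / β ^ (n + s + L) = u / β ^ s := by
      rw [hzx, pow_add, pow_add]
      field_simp
      ring
    have hn1 : 1 ≤ β ^ n := one_le_pow₀ hβ.one_lt.le
    have hxL : x / β ^ L ≤ 1 := by
      rw [div_le_one (by positivity)]
      exact hx.2.le.trans (one_le_pow₀ hβ.one_lt.le)
    have hzI : (z : ℝ) / β ^ (n + s) ∈ Set.Ico (0 : ℝ) 1 := by
      constructor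
      · refine div_nonneg ?_ (by positivity)
        rw [hzx]
        nlinarith [hag.1]
      · have h1 : (u : ℝ) / β ^ s < 1 := by
          rw [div_lt_one (by positivity)]
          linarith [hag.2]
        have h2 : 0 ≤ x / β ^ (n + s + L) := div_nonneg hx.1 (by positivity)
        linarith
    have h0 := hL z hz hzφ (n + s) hzI
    rw [← hzu, betaTransform_iterate_add hβ0.le (div_nonneg hx.1 (by positivity)), h0, zero_add,
      mul_div_cancel₀ _ (by positivity)]
    intro i hi
    -- No carry: at time `i` the finite part has `j` digits left, and the gap below `1` exceeds
    -- `x/β^j`.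
    obtain ⟨j, hj⟩ := Nat.exists_eq_add_of_le' hi
    rw [hj, Function.iterate_add_apply] at h0
    have h1 := hgap _ (betaTransform_iterate_mem_Ico hzI i) j h0
    refine lt_of_le_of_lt ?_ h1
    have h2 : β ^ i * (x / β ^ (n + s + L)) = x / β ^ j := by
      rw [hj, pow_add]
      field_simp
    rw [h2]
    gcongr
  choose u huS hux using key
  obtain ⟨k, -, l, -, hkl, huu⟩ := Set.infinite_univ.exists_lt_map_eq_of_mapsTo
    (fun k _ ↦ huS k) hSfin
  refine hasPurelyPeriodicBetaExpansion_of_iterate_eq (v := (u k : ℝ) / β ^ s)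
    (m := k₀ + k + s + L) (n := k₀ + l + s + L) (by omega) (hux k) ?_
  rw [huu]
  exact hux l
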